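/- Let $d$ be a nonnegative integer and let $\mathcal{P} \subset \mathbb{R}^d$ be a convex body (a nonempty compact convex set) in John's position, meaning that the maximum volume ellipsoid contained in $\mathcal{P}$ is the closed Euclidean unit ball $B_2 = \{x \in \mathbb{R}^d : \|x\|_2 \le 1\}$ centered at $0$ (in particular, $\mathcal{P}$ has nonempty interior). Here an ellipsoid is a set $\{c + A u : u \in B_2\}$ with $c \in \mathbb{R}^d$ and $A \in \mathbb{R}^{d \times d}$ invertible. Let $M \in \mathbb{R}^{d \times d}$ and $a \in \mathbb{R}^d$ be such that $\phi(p) = Mp + a$ is an affine endomorphism of $\mathcal{P}$, that is, $\phi(p) \in \mathcal{P}$ for every $p \in \mathcal{P}$. Then the Frobenius norm of $M$ satisfies $$\|M\|_F \le \sqrt{d + \|a\|_2^2}.$$ Moreover, if $\mathcal{P}$ is centrally symmetric (that is, $\mathcal{P} = -\mathcal{P}$), then $\|a\|_2 \le \sqrt{d}$ and $\|M\|_F \le \sqrt{2d}$. -/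

import Mathlib

open scoped Matrix.Norms.Frobenius

/-- An ellipsoid in `ℝ^d`: the image `{c + A u : ‖u‖ ≤ 1}` of the closed Euclidean unit ball
under an invertible affine map. -/
def IsEllipsoid {d : ℕ} (E : Set (EuclideanSpace ℝ (Fin d))) : Prop :=
  ∃ (A : EuclideanSpace ℝ (Fin d) ≃ₗ[ℝ] EuclideanSpace ℝ (Fin d))
    (c : EuclideanSpace ℝ (Fin d)),
    E = (fun u => c + A u) '' Metric.closedBall 0 1

/-- `E` is a maximum volume ellipsoid contained in `P`. Uniqueness of the maximizer is a theorem
about convex bodies and is not part of the definition. -/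
structure IsMaxVolumeEllipsoid {d : ℕ} (P E : Set (EuclideanSpace ℝ (Fin d))) : Prop where
  isEllipsoid : IsEllipsoid E
  subset : E ⊆ P
  volume_le : ∀ E' : Set (EuclideanSpace ℝ (Fin d)), IsEllipsoid E' → E' ⊆ P →
    MeasureTheory.volume E' ≤ MeasureTheory.volume E

/-- `P` is in John's position: the maximum volume ellipsoid contained in `P` is the Euclidean
unit ball centered at `0`. In particular such a `P` has nonempty interior. -/
def InJohnPosition {d : ℕ} (P : ConvexBody (EuclideanSpace ℝ (Fin d))) : Prop :=
  IsMaxVolumeEllipsoid (P : Set (EuclideanSpace ℝ (Fin d))) (Metric.closedBall 0 1)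

/-- `P` is centrally symmetric (about the origin): `P = -P`. -/
def IsCentrallySymmetric {d : ℕ} (P : ConvexBody (EuclideanSpace ℝ (Fin d))) : Prop :=
  ∀ p ∈ P, -p ∈ P

/-- The affine map `p ↦ M p + a` on `ℝ^d`. -/
noncomputable def affineFun {d : ℕ} (M : Matrix (Fin d) (Fin d) ℝ)
    (a : EuclideanSpace ℝ (Fin d)) (p : EuclideanSpace ℝ (Fin d)) : EuclideanSpace ℝ (Fin d) :=
  Matrix.toEuclideanLin M p + a

/-- `φ` is an endomorphism of `P`: `φ(P) ⊆ P`. -/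
def IsEndomorphism {d : ℕ} (P : ConvexBody (EuclideanSpace ℝ (Fin d)))
    (φ : EuclideanSpace ℝ (Fin d) → EuclideanSpace ℝ (Fin d)) : Prop :=
  Set.MapsTo φ (P : Set (EuclideanSpace ℝ (Fin d))) (P : Set (EuclideanSpace ℝ (Fin d)))

/-!
Moving the unit ball by `v ↦ v + t • w v`, for a continuous field `w` that points strictly inwards
at every contact direction, keeps it inside `P` for small `t > 0`. If `w v = h + T v`, the moved
ball is an ellipsoid of volume `|det (1 + t • T)|` times that of the ball, and maximality makes the
derivative `trace T` at `t = 0` nonpositive. Replacing `T` by `T - δ • 1` and letting `δ → 0`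
weakens the condition `⟪u, h + T u⟫ < 0` at contact directions `u` to `⟪u, h + T u⟫ ≤ 0`.

If `p ↦ A p + a` maps the unit ball into `P`, then `‖A† u‖ ≤ 1 - ⟪u, a⟫` at a contact direction `u`.
Squared, this is the inequality above for `h = 2a` and `T = A A† - 1 - a aᵀ`, whose trace is
`‖A‖_F² - d - ‖a‖²`. When `P` contains `a` and `-a`, the same bound for the linear map `t ↦ t • a`
from `[-1, 1]` into `P` gives `‖a‖² ≤ d`.
-/

open Filter Topology MeasureTheory Metric Module

section Determinant

variable {𝕜 : Type*} [NontriviallyNormedField 𝕜]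

lemma hasDerivAt_matrix_det_one_add_smul {n : Type*} [Fintype n] [DecidableEq n]
    (M : Matrix n n 𝕜) : HasDerivAt (fun t : 𝕜 => (1 + t • M).det) M.trace 0 := by
  have hderiv := (1 + (Polynomial.X : Polynomial 𝕜) • M.map Polynomial.C).det.hasDerivAt 0
  rw [Matrix.derivative_det_one_add_X_smul] at hderiv
  refine hderiv.congr_of_eventuallyEq (.of_forall fun t => ?_)
  simp [eval_det, ← Matrix.smul_eq_mul_diagonal]

lemma hasDerivAt_det_one_add_smul {V : Type*} [AddCommGroup V] [Module 𝕜 V]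
    [FiniteDimensional 𝕜 V] (T : V →ₗ[𝕜] V) :
    HasDerivAt (fun t : 𝕜 => LinearMap.det (1 + t • T)) (LinearMap.trace 𝕜 V T) 0 := by
  let b := finBasis 𝕜 V
  simpa only [LinearMap.trace_eq_matrix_trace 𝕜 b, ← LinearMap.det_toMatrix b, map_add, map_smul,
    LinearMap.toMatrix_one] using hasDerivAt_matrix_det_one_add_smul (LinearMap.toMatrix b b T)

end Determinant

section InnerProductSpace

variable {E F : Type*} [NormedAddCommGroup E] [InnerProductSpace ℝ E]
  [NormedAddCommGroup F] [InnerProductSpace ℝ F]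

lemma mem_of_forall_norm_eq_one_exists_inner_le [CompleteSpace E] {s : Set E}
    (hconvex : Convex ℝ s) (hclosed : IsClosed s) (hne : s.Nonempty) {x : E}
    (hx : ∀ u : E, ‖u‖ = 1 → ∃ p ∈ s, inner ℝ u x ≤ inner ℝ u p) : x ∈ s := by
  by_contra hxs
  obtain ⟨f, c, hfs, hfx⟩ := geometric_hahn_banach_closed_point hconvex hclosed hxs
  set w := (InnerProductSpace.toDual ℝ E).symm f
  have hw (y : E) : inner ℝ w y = f y := InnerProductSpace.toDual_symm_apply
  have hsep (p : E) (hp : p ∈ s) : inner ℝ w p < inner ℝ w x := by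
    simpa only [hw] using (hfs p hp).trans hfx
  have hw0 : w ≠ 0 := by
    intro h
    obtain ⟨p, hp⟩ := hne
    simpa [h] using hsep p hp
  obtain ⟨p, hp, hle⟩ := hx (‖w‖⁻¹ • w) (norm_smul_inv_norm hw0)
  rw [real_inner_smul_left, real_inner_smul_left] at hle
  exact (hsep p hp).not_ge (le_of_mul_le_mul_left hle (inv_pos.2 (norm_pos_iff.2 hw0)))

/-- A contact direction of `s`: a unit vector `u` whose hyperplane `⟪u, x⟫ = 1` has `s` on one
side. When `s` contains the unit ball, these are the points where the unit sphere touches the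
boundary of `s`. -/
structure IsContactDirection (s : Set E) (u : E) : Prop where
  norm_eq_one : ‖u‖ = 1
  inner_le_one : ∀ p ∈ s, inner ℝ u p ≤ 1

lemma IsContactDirection.inner_self {s : Set E} {u : E} (hu : IsContactDirection s u) :
    inner ℝ u u = 1 :=
  inner_self_eq_one_of_norm_eq_one hu.norm_eq_one

lemma isContactDirection_and_eq_of_forall_inner_le {s : Set E} {u v : E} (hus : u ∈ s)
    (hu : ‖u‖ = 1) (hv : ‖v‖ ≤ 1)
    (hmax : ∀ p ∈ s, inner ℝ u p ≤ inner ℝ u v) : IsContactDirection s u ∧ v = u := by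
  have hcauchy : inner ℝ u v ≤ ‖v‖ := by simpa [hu] using real_inner_le_norm u v
  have hge : 1 ≤ inner ℝ u v := by
    simpa [real_inner_self_eq_norm_sq, hu] using hmax u hus
  have hv1 : ‖v‖ = 1 := hv.antisymm (hge.trans hcauchy)
  have huv : inner ℝ u v = 1 := (hcauchy.trans hv).antisymm hge
  exact ⟨⟨hu, fun p hp => (hmax p hp).trans huv.le⟩,
    ((inner_eq_one_iff_of_norm_eq_one hu hv1).1 huv).symm⟩

lemma eventually_exists_inner_add_smul_le {s : Set E} (hball : closedBall 0 1 ⊆ s) {w : E → E}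
    (hw : Continuous w) (hinward : ∀ u, IsContactDirection s u → inner ℝ u (w u) < 0)
    {u₀ v₀ : E} (hu₀ : ‖u₀‖ = 1) (hv₀ : ‖v₀‖ ≤ 1) :
    ∀ᶠ z : ℝ × E × E in 𝓝 (0, u₀, v₀), 0 < z.1 → z.2.2 ∈ s →
      ∃ p ∈ s, inner ℝ z.2.1 (z.2.2 + z.1 • w z.2.2) ≤ inner ℝ z.2.1 p := by
  by_cases hmax : ∀ p ∈ s, inner ℝ u₀ p ≤ inner ℝ u₀ v₀
  · have hus : u₀ ∈ s := hball (by simp [hu₀])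
    obtain ⟨hcontact, rfl⟩ := isContactDirection_and_eq_of_forall_inner_le hus hu₀ hv₀ hmax
    have hneg : ∀ᶠ z : ℝ × E × E in 𝓝 (0, v₀, v₀), inner ℝ z.2.1 (w z.2.2) < 0 :=
      ContinuousAt.eventually_lt (by fun_prop) continuousAt_const (hinward v₀ hcontact)
    filter_upwards [hneg] with z hz ht hvs
    refine ⟨z.2.2, hvs, ?_⟩
    rw [inner_add_right, real_inner_smul_right]
    exact add_le_of_nonpos_right (mul_nonpos_of_nonneg_of_nonpos ht.le hz.le)
  · push Not at hmax
    obtain ⟨p, hp, hlt⟩ := hmax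
    have hnear : ∀ᶠ z : ℝ × E × E in 𝓝 (0, u₀, v₀),
        inner ℝ z.2.1 (z.2.2 + z.1 • w z.2.2) < inner ℝ z.2.1 p :=
      ContinuousAt.eventually_lt (by fun_prop) (by fun_prop) (by simpa using hlt)
    exact hnear.mono fun z hz _ _ => ⟨p, hp, hz.le⟩

lemma eventually_forall_add_smul_mem [ProperSpace E] {s : Set E} (hconvex : Convex ℝ s)
    (hclosed : IsClosed s) (hball : closedBall 0 1 ⊆ s) {w : E → E} (hw : Continuous w)
    (hinward : ∀ u, IsContactDirection s u → inner ℝ u (w u) < 0) :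
    ∀ᶠ t : ℝ in 𝓝[>] 0, ∀ v ∈ closedBall (0 : E) 1, v + t • w v ∈ s := by
  have hcompact : IsCompact (sphere (0 : E) 1 ×ˢ closedBall (0 : E) 1) :=
    (isCompact_sphere 0 1).prod (isCompact_closedBall 0 1)
  have hunif : ∀ᶠ t : ℝ in 𝓝 0, ∀ y ∈ sphere (0 : E) 1 ×ˢ closedBall (0 : E) 1,
      0 < t → y.2 ∈ s → ∃ p ∈ s, inner ℝ y.1 (y.2 + t • w y.2) ≤ inner ℝ y.1 p :=
    hcompact.eventually_forall_of_forall_eventually fun y hy =>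
      eventually_exists_inner_add_smul_le hball hw hinward (mem_sphere_zero_iff_norm.1 hy.1)
        (mem_closedBall_zero_iff.1 hy.2)
  filter_upwards [nhdsWithin_le_nhds hunif, self_mem_nhdsWithin] with t ht htpos v hv
  have hne : s.Nonempty := ⟨v, hball hv⟩
  exact mem_of_forall_norm_eq_one_exists_inner_le hconvex hclosed hne fun u hu =>
    ht (u, v) ⟨mem_sphere_zero_iff_norm.2 hu, hv⟩ htpos (hball hv)

lemma trace_comp_adjoint_eq_sum_norm_sq [FiniteDimensional ℝ E] [FiniteDimensional ℝ F]
    {ι : Type*} [Fintype ι] (A : F →ₗ[ℝ] E) (b : OrthonormalBasis ι ℝ F) :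
    LinearMap.trace ℝ E (A ∘ₗ A.adjoint) = ∑ i, ‖A (b i)‖ ^ 2 := by
  simp only [LinearMap.trace_comp_comm', LinearMap.trace_eq_sum_inner _ b, LinearMap.comp_apply,
    LinearMap.adjoint_inner_right, real_inner_self_eq_norm_sq]

lemma IsContactDirection.norm_adjoint_add_inner_le_one [FiniteDimensional ℝ E]
    [FiniteDimensional ℝ F] {s : Set E} {u : E} (hu : IsContactDirection s u) {A : F →ₗ[ℝ] E}
    {a : E} (hA : Set.MapsTo (fun p => A p + a) (closedBall 0 1) s) :
    ‖A.adjoint u‖ + inner ℝ u a ≤ 1 := by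
  set w := A.adjoint u with hw
  have hmem : ‖w‖⁻¹ • w ∈ closedBall (0 : F) 1 := by
    simpa [norm_smul] using inv_mul_le_one
  have hnorm : inner ℝ u (A (‖w‖⁻¹ • w)) = ‖w‖ := by
    rw [← LinearMap.adjoint_inner_left, ← hw, real_inner_smul_right,
      real_inner_self_eq_norm_mul_norm, ← mul_assoc, inv_mul_mul_self]
  simpa only [inner_add_right, hnorm] using hu.inner_le_one _ (hA hmem)

end InnerProductSpace

lemma frobenius_norm_sq_eq_sum_norm_sq {m n : Type*} [Fintype m] [Fintype n] [DecidableEq n]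
    (M : Matrix m n ℝ) :
    ‖M‖ ^ 2 = ∑ j, ‖Matrix.toEuclideanLin M (EuclideanSpace.basisFun n ℝ j)‖ ^ 2 := by
  rw [Matrix.frobenius_norm_def, ← Real.sqrt_eq_rpow, Real.sq_sqrt (by positivity),
    Finset.sum_comm]
  simp [EuclideanSpace.real_norm_sq_eq, Matrix.toLpLin_apply]

namespace InJohnPosition

variable {d : ℕ} {P : ConvexBody (EuclideanSpace ℝ (Fin d))}

lemma abs_det_le_one (hP : InJohnPosition P)
    {T : EuclideanSpace ℝ (Fin d) →ₗ[ℝ] EuclideanSpace ℝ (Fin d)} {c : EuclideanSpace ℝ (Fin d)}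
    (hT : Set.MapsTo (fun v => c + T v) (closedBall 0 1) P) : |LinearMap.det T| ≤ 1 := by
  rcases eq_or_ne (LinearMap.det T) 0 with hdet | hdet
  · simp [hdet]
  have hvol := hP.volume_le ((fun v => c + T v) '' closedBall 0 1)
    ⟨LinearMap.equivOfDetNeZero T hdet, c, rfl⟩ hT.image_subset
  rw [← Set.image_image (c + ·) T, Set.image_add_left, measure_preimage_add,
    Measure.addHaar_image_linearMap] at hvol
  have hscale : ENNReal.ofReal |LinearMap.det T| ≤ 1 :=
    (ENNReal.mul_le_mul_iff_left (measure_closedBall_pos volume _ one_pos).ne'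
      measure_closedBall_lt_top.ne).1 (hvol.trans_eq (one_mul _).symm)
  exact ENNReal.ofReal_le_one.1 hscale

lemma trace_nonpos_of_forall_inner_neg (hP : InJohnPosition P)
    {T : EuclideanSpace ℝ (Fin d) →ₗ[ℝ] EuclideanSpace ℝ (Fin d)} {h : EuclideanSpace ℝ (Fin d)}
    (hinward : ∀ u, IsContactDirection (P : Set (EuclideanSpace ℝ (Fin d))) u →
      inner ℝ u (h + T u) < 0) :
    LinearMap.trace ℝ _ T ≤ 0 := by
  have hcont : Continuous fun v => h + T v :=
    continuous_const.add T.continuous_of_finiteDimensional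
  have hmaps := eventually_forall_add_smul_mem P.convex P.isClosed hP.subset hcont hinward
  have hdet : ∀ᶠ t : ℝ in 𝓝[>] 0, LinearMap.det (1 + t • T) ≤ 1 := by
    filter_upwards [hmaps] with t ht
    refine (le_abs_self _).trans (hP.abs_det_le_one (c := t • h) fun v hv => ?_)
    convert ht v hv using 1
    simp only [LinearMap.add_apply, Module.End.one_apply, LinearMap.smul_apply]
    module
  refine le_of_tendsto (hasDerivAt_det_one_add_smul T).tendsto_slope_zero_right ?_
  filter_upwards [hdet, self_mem_nhdsWithin] with t ht htpos
  rw [zero_add, zero_smul, add_zero, map_one]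
  exact smul_nonpos_of_nonneg_of_nonpos (inv_nonneg.2 htpos.le) (sub_nonpos.2 ht)

lemma trace_nonpos_of_forall_inner_nonpos (hP : InJohnPosition P)
    {T : EuclideanSpace ℝ (Fin d) →ₗ[ℝ] EuclideanSpace ℝ (Fin d)} {h : EuclideanSpace ℝ (Fin d)}
    (hinward : ∀ u, IsContactDirection (P : Set (EuclideanSpace ℝ (Fin d))) u →
      inner ℝ u (h + T u) ≤ 0) :
    LinearMap.trace ℝ _ T ≤ 0 := by
  have hperturb (δ : ℝ) (hδ : 0 < δ) : LinearMap.trace ℝ _ T ≤ δ * d := by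
    have htrace := hP.trace_nonpos_of_forall_inner_neg (T := T - δ • 1) (h := h) fun u hu => by
      have hle := hinward u hu
      simp only [LinearMap.sub_apply, LinearMap.smul_apply, Module.End.one_apply, ← add_sub_assoc,
        inner_sub_right, real_inner_smul_right, hu.inner_self]
      linarith
    simpa [LinearMap.trace_one] using htrace
  have hlim : Tendsto (fun δ : ℝ => δ * d) (𝓝[>] 0) (𝓝 0) := by
    simpa using ((continuous_mul_const (d : ℝ)).tendsto 0).mono_left nhdsWithin_le_nhds
  exact ge_of_tendsto hlim (eventually_mem_nhdsWithin.mono hperturb)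

lemma sum_norm_sq_le_of_mapsTo (hP : InJohnPosition P) {F ι : Type*} [NormedAddCommGroup F]
    [InnerProductSpace ℝ F] [FiniteDimensional ℝ F] [Fintype ι] (b : OrthonormalBasis ι ℝ F)
    {A : F →ₗ[ℝ] EuclideanSpace ℝ (Fin d)} {a : EuclideanSpace ℝ (Fin d)}
    (hA : Set.MapsTo (fun p => A p + a) (closedBall 0 1) P) :
    ∑ i, ‖A (b i)‖ ^ 2 ≤ d + ‖a‖ ^ 2 := by
  let T := A ∘ₗ A.adjoint - 1 - (InnerProductSpace.rankOne ℝ a a).toLinearMap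
  have hT (u : EuclideanSpace ℝ (Fin d)) (hu : IsContactDirection (P : Set _) u) :
      inner ℝ u ((2 : ℝ) • a + T u) = ‖A.adjoint u‖ ^ 2 - (1 - inner ℝ u a) ^ 2 := by
    simp only [T, LinearMap.sub_apply, LinearMap.comp_apply, Module.End.one_apply,
      ContinuousLinearMap.coe_coe, InnerProductSpace.rankOne_apply, inner_add_right,
      inner_sub_right, real_inner_smul_right, ← LinearMap.adjoint_inner_left A,
      real_inner_self_eq_norm_sq, hu.norm_eq_one, real_inner_comm u a]
    ring
  have htrace : LinearMap.trace ℝ _ T = ∑ i, ‖A (b i)‖ ^ 2 - d - ‖a‖ ^ 2 := by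
    simp [T, trace_comp_adjoint_eq_sum_norm_sq A b, InnerProductSpace.trace_rankOne,
      LinearMap.trace_one]
  have hle : LinearMap.trace ℝ _ T ≤ 0 := hP.trace_nonpos_of_forall_inner_nonpos fun u hu => by
    rw [hT u hu, sub_nonpos]
    have hbound := hu.norm_adjoint_add_inner_le_one hA
    gcongr
    linarith
  linarith

lemma norm_sq_le_of_mem_of_neg_mem (hP : InJohnPosition P) {a : EuclideanSpace ℝ (Fin d)}
    (ha : a ∈ P) (hna : -a ∈ P) : ‖a‖ ^ 2 ≤ d := by
  have hsegment : Set.MapsTo (fun t => LinearMap.toSpanSingleton ℝ _ a t + 0) (closedBall 0 1)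
      (P : Set (EuclideanSpace ℝ (Fin d))) := fun t ht => by
    obtain ⟨hlow, hupp⟩ : -1 ≤ t ∧ t ≤ 1 := by simpa [abs_le] using ht
    have hcomb := P.convex ha hna (a := (1 + t) / 2) (b := (1 - t) / 2) (by linarith)
      (by linarith) (by ring)
    convert hcomb using 1
    simp only [LinearMap.toSpanSingleton_apply]
    module
  simpa using hP.sum_norm_sq_le_of_mapsTo (OrthonormalBasis.singleton Unit ℝ) hsegment

end InJohnPosition

theorem mainTheorem8_general {d : ℕ} {n : Type*} [Fintype n] [DecidableEq n]
    (P : ConvexBody (EuclideanSpace ℝ (Fin d))) (hP : InJohnPosition P)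
    (M : Matrix (Fin d) n ℝ) (a : EuclideanSpace ℝ (Fin d))
    (hφ : Set.MapsTo (fun p => Matrix.toEuclideanLin M p + a) (closedBall 0 1) P) :
    ‖M‖ ≤ Real.sqrt ((d : ℝ) + ‖a‖ ^ 2) ∧
      (IsCentrallySymmetric P →
        ‖a‖ ≤ Real.sqrt (d : ℝ) ∧ ‖M‖ ≤ Real.sqrt (2 * (d : ℝ))) := by
  have hM : ‖M‖ ^ 2 ≤ d + ‖a‖ ^ 2 := by
    rw [frobenius_norm_sq_eq_sum_norm_sq]
    exact hP.sum_norm_sq_le_of_mapsTo _ hφ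
  refine ⟨Real.le_sqrt_of_sq_le hM, fun hsymm => ?_⟩
  have ha : a ∈ P := by simpa using hφ (mem_closedBall_self zero_le_one)
  have had : ‖a‖ ^ 2 ≤ d := hP.norm_sq_le_of_mem_of_neg_mem ha (hsymm a ha)
  exact ⟨Real.le_sqrt_of_sq_le had, Real.le_sqrt_of_sq_le (by linarith)⟩

/-- The norm `‖M‖` of the matrix `M` is the Frobenius norm; `‖a‖` is the Euclidean norm. -/
theorem mainTheorem8 (d : ℕ) (P : ConvexBody (EuclideanSpace ℝ (Fin d)))
    (hP : InJohnPosition P) (M : Matrix (Fin d) (Fin d) ℝ) (a : EuclideanSpace ℝ (Fin d))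
    (hφ : IsEndomorphism P (affineFun M a)) :
    ‖M‖ ≤ Real.sqrt ((d : ℝ) + ‖a‖ ^ 2) ∧
      (IsCentrallySymmetric P →
        ‖a‖ ≤ Real.sqrt (d : ℝ) ∧ ‖M‖ ≤ Real.sqrt (2 * (d : ℝ))) :=
  mainTheorem8_general P hP M a (hφ.mono_left hP.subset)
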